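/- Let $(M,\rho,\mu)$ be a space of homogeneous type: $\rho$ is a quasi-distance on $M$ (nonnegative, symmetric, $\rho(x,y)=0$ iff $x=y$, and $\rho(x,z)\le K(\rho(x,y)+\rho(y,z))$ for some constant $K$), and $\mu$ is a measure for which all balls are measurable with positive finite measure and which is doubling. Assume that $\mu$ is $\sigma$-finite and $\mu(M)=\infty$. All functions are complex-valued and identified when equal almost everywhere. A $(1,2)$-atom is a function $a\in L^2(M)$ with $\int_M a\,d\mu=0$ that is supported in some closed ball $B=\{y:\rho(c,y)\le r\}$, $r>0$, and satisfies $\bigl(\frac1{\mu(B)}\int_B|a|^2\,d\mu\bigr)^{1/2}\le\mu(B)^{-1}$. Let $H^{1,2}_{\rm fin}(M)$ be the space of finite linear combinations of $(1,2)$-atoms. Let $H^1(M)$ be the space of all $g\in L^1(M)$ that can be written as $g=\sum_{j}\lambda_j a_j$ in $L^1(M)$, with $(1,2)$-atoms $a_j$ and $\lambda_j\in\mathbb C$, $\sum_j|\lambda_j|<\infty$; its norm $\|g\|_{H^1}$ is the infimum of $\sum_j|\lambda_j|$ over all such decompositions. **Proposition 4.2.** Let $T$ be a bounded linear operator on $L^2(M)$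 such that $$\sup\{\|Ta\|_{L^1(M)} : a \text{ is a } (1,2)\text{-atom}\}<\infty .$$ Then there is a unique bounded linear operator $\widetilde T:H^1(M)\to L^1(M)$ that coincides with $T$ on $H^{1,2}_{\rm fin}(M)$, and $\widetilde T g=Tg$ almost everywhere for every $g\in H^1(M)\cap L^2(M)$. -/

import Mathlib

open MeasureTheory
open scoped NNReal ENNReal

noncomputable section

namespace HomType

variable {M : Type*}

/-- The closed ball of centre `c` and radius `r` for a quasi-distance `ρ`. -/
def qball (ρ : M → M → ℝ) (c : M) (r : ℝ) : Set M := {y | ρ c y ≤ r}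

variable [MeasurableSpace M]

/-- `(M, ρ, μ)` is a space of homogeneous type: `ρ` is a quasi-distance, balls are measurable
with positive and finite measure, and `μ` is doubling. (It is equivalent to impose the conditions
on all open balls or on all closed balls. The σ-algebra may be any one that contains the balls,
for instance the Borel σ-algebra when the open balls are a base of the topology.) -/
structure IsHomogeneousType (ρ : M → M → ℝ) (μ : Measure M) : Prop where
  nonneg : ∀ x y, 0 ≤ ρ x y
  eq_zero_iff : ∀ x y, ρ x y = 0 ↔ x = y
  symm : ∀ x y, ρ x y = ρ y x
  quasi_triangle : ∃ K : ℝ, ∀ x y z, ρ x z ≤ K * (ρ x y + ρ y z)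
  measurableSet_qball : ∀ x r, 0 < r → MeasurableSet (qball ρ x r)
  measure_qball_pos : ∀ x r, 0 < r → 0 < μ (qball ρ x r)
  measure_qball_lt_top : ∀ x r, 0 < r → μ (qball ρ x r) < ∞
  doubling : ∃ D : ℝ≥0, ∀ x r, 0 < r → μ (qball ρ x (2 * r)) ≤ D * μ (qball ρ x r)

/-- `(1,q)`-atoms: functions `a` in `L^q(μ)` with integral zero that vanish (almost everywhere)
outside some ball `B` and satisfy `(μ(B)⁻¹ ∫ |a|^q)^(1/q) ≤ μ(B)⁻¹`; for `q = ∞`, where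
`1 / q.toReal = 0`, the last condition is `‖a‖_∞ ≤ μ(B)⁻¹`. -/
def IsAtom (ρ : M → M → ℝ) (μ : Measure M) (q : ℝ≥0∞) (a : M → ℂ) : Prop :=
  MemLp a q μ ∧ ∫ x, a x ∂μ = 0 ∧
    ∃ (c : M) (r : ℝ), 0 < r ∧ (∀ᵐ x ∂μ, x ∉ qball ρ c r → a x = 0) ∧
      (μ (qball ρ c r))⁻¹ ^ (1 / q.toReal) * eLpNorm a q μ ≤ (μ (qball ρ c r))⁻¹

/-- `g = ∑ⱼ lⱼ aⱼ` in `L¹(μ)`, with `(1,q)`-atoms `aⱼ` and `∑ⱼ |lⱼ| < ∞`. -/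
def IsAtomicDecomposition (ρ : M → M → ℝ) (μ : Measure M) (q : ℝ≥0∞) (g : Lp ℂ 1 μ)
    (l : ℕ → ℂ) (a : ℕ → Lp ℂ 1 μ) : Prop :=
  (∀ j, IsAtom ρ μ q (a j)) ∧ Summable (fun j => ‖l j‖) ∧ HasSum (fun j => l j • a j) g

theorem isAtom_zero [Nonempty M] (ρ : M → M → ℝ) (μ : Measure M) (q : ℝ≥0∞) :
    IsAtom ρ μ q ((0 : Lp ℂ 1 μ) : M → ℂ) := by
  have h0 : ((0 : Lp ℂ 1 μ) : M → ℂ) =ᵐ[μ] 0 := Lp.coeFn_zero ℂ 1 μ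
  refine ⟨(memLp_congr_ae h0).2 MemLp.zero, ?_, Classical.arbitrary M, 1, one_pos, ?_, ?_⟩
  · rw [integral_congr_ae h0]; simp
  · filter_upwards [h0] with x hx _ using hx
  · rw [eLpNorm_congr_ae h0]; simp

theorem IsAtomicDecomposition.zero [Nonempty M] (ρ : M → M → ℝ) (μ : Measure M) (q : ℝ≥0∞) :
    IsAtomicDecomposition ρ μ q 0 (fun _ => 0) (fun _ => 0) := by
  refine ⟨fun _ => isAtom_zero ρ μ q, ?_, ?_⟩
  · simp only [norm_zero]
    exact summable_zero
  · simp only [smul_zero]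
    exact hasSum_zero

theorem IsAtomicDecomposition.add {ρ : M → M → ℝ} {μ : Measure M} {q : ℝ≥0∞} {f g : Lp ℂ 1 μ}
    {l l' : ℕ → ℂ} {a a' : ℕ → Lp ℂ 1 μ} (hf : IsAtomicDecomposition ρ μ q f l a)
    (hg : IsAtomicDecomposition ρ μ q g l' a') :
    IsAtomicDecomposition ρ μ q (f + g)
      (fun j => Sum.elim l l' (Equiv.natSumNatEquivNat.symm j))
      (fun j => Sum.elim a a' (Equiv.natSumNatEquivNat.symm j)) := by
  obtain ⟨ha, hl, hs⟩ := hf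
  obtain ⟨ha', hl', hs'⟩ := hg
  refine ⟨fun j => ?_, ?_, ?_⟩
  · beta_reduce
    rcases Equiv.natSumNatEquivNat.symm j with i | i
    · exact ha i
    · exact ha' i
  · exact (Equiv.natSumNatEquivNat.symm.summable_iff
      (f := fun x : ℕ ⊕ ℕ => ‖Sum.elim l l' x‖)).2 (Summable.sum _ hl hl')
  · exact (Equiv.natSumNatEquivNat.symm.hasSum_iff
      (f := fun x : ℕ ⊕ ℕ => Sum.elim l l' x • Sum.elim a a' x)).2 (HasSum.sum hs hs')

theorem IsAtomicDecomposition.smul {ρ : M → M → ℝ} {μ : Measure M} {q : ℝ≥0∞} {f : Lp ℂ 1 μ}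
    {l : ℕ → ℂ} {a : ℕ → Lp ℂ 1 μ} (c : ℂ) (hf : IsAtomicDecomposition ρ μ q f l a) :
    IsAtomicDecomposition ρ μ q (c • f) (fun j => c * l j) a := by
  obtain ⟨ha, hl, hs⟩ := hf
  refine ⟨ha, ?_, ?_⟩
  · simp only [norm_mul]
    exact hl.mul_left ‖c‖
  · simp only [mul_smul]
    exact hs.const_smul c

/-- The atomic space `H^{1,q}(μ)`, a linear subspace of `L¹(μ)`. -/
def hardyq [Nonempty M] (ρ : M → M → ℝ) (μ : Measure M) (q : ℝ≥0∞) :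
    Submodule ℂ (Lp ℂ 1 μ) where
  carrier := {g | ∃ l a, IsAtomicDecomposition ρ μ q g l a}
  zero_mem' := ⟨_, _, IsAtomicDecomposition.zero ρ μ q⟩
  add_mem' := fun ⟨_, _, hf⟩ ⟨_, _, hg⟩ => ⟨_, _, hf.add hg⟩
  smul_mem' := fun c _ ⟨_, _, hf⟩ => ⟨_, _, hf.smul c⟩

/-- The norm of `H^{1,q}(μ)`: the infimum of `∑ⱼ |lⱼ|` over all atomic decompositions. -/
def hardyqNorm (ρ : M → M → ℝ) (μ : Measure M) (q : ℝ≥0∞) (g : Lp ℂ 1 μ) : ℝ :=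
  sInf {s | ∃ l a, IsAtomicDecomposition ρ μ q g l a ∧ s = ∑' j, ‖l j‖}

/-- The space `H^{1,q}_fin(μ)` of all finite linear combinations of `(1,q)`-atoms. -/
def hardyqFin (ρ : M → M → ℝ) (μ : Measure M) (q : ℝ≥0∞) : Submodule ℂ (Lp ℂ 1 μ) :=
  Submodule.span ℂ {a | IsAtom ρ μ q a}

/-- The atomic Hardy space `H¹(μ)`, realized with `(1,2)`-atoms. -/
abbrev hardy [Nonempty M] (ρ : M → M → ℝ) (μ : Measure M) : Submodule ℂ (Lp ℂ 1 μ) :=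
  hardyq ρ μ 2

/-- The norm of `H¹(μ)`. -/
abbrev hardyNorm (ρ : M → M → ℝ) (μ : Measure M) (g : Lp ℂ 1 μ) : ℝ := hardyqNorm ρ μ 2 g

/-- The linear operator `S : H¹(μ) → L¹(μ)` is bounded (for the norm of `H¹(μ)`) and coincides
with the operator `T` of `L²(μ)` on `H^{1,2}_fin(μ)`, whose elements are in `L²(μ)`. -/
def IsBoundedExtension [Nonempty M] (ρ : M → M → ℝ) (μ : Measure M)
    (T : Lp ℂ 2 μ →L[ℂ] Lp ℂ 2 μ) (S : hardy ρ μ →ₗ[ℂ] Lp ℂ 1 μ) : Prop :=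
  (∃ C : ℝ, ∀ g : hardy ρ μ, ‖S g‖ ≤ C * hardyNorm ρ μ g) ∧
    ∀ (g : hardy ρ μ) (h : Lp ℂ 2 μ), (g : Lp ℂ 1 μ) ∈ hardyqFin ρ μ 2 →
      (g : Lp ℂ 1 μ) =ᵐ[μ] h → S g =ᵐ[μ] T h

end HomType

end

/-!
The point is that on `H¹ ∩ L²` the value of `T` can be computed along any atomic decomposition: if
`∑ⱼ lⱼ aⱼ` converges in `L¹` to some `h ∈ L²`, then `T h = ∑ⱼ lⱼ T aⱼ` almost everywhere
(`HomType.IsAtomicImage.ae_eq`). Applied to `h = 0` this shows that `∑ⱼ lⱼ aⱼ ↦ ∑ⱼ lⱼ T aⱼ` is a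
well-defined linear map on `H¹`, which is then clearly bounded by the supremum `A` of `‖T a‖₁` over
all atoms; applied to general `h` it shows that this map agrees with `T` on `H¹ ∩ L²`. Any other
bounded extension is the same map, because partial sums of atomic decompositions converge in the
norm of `H¹`.

The identity is tested against indicators `1ₛ` of sets of finite measure, where it reads
`⟪b, h⟫ = ∑ⱼ lⱼ ⟪b, aⱼ⟫` with `b = T† 1ₛ ∈ L²`. It would follow from the `L¹` convergence if `b` were
bounded. In general `b` is replaced by its truncations `bₙ`, and the limit `n → ∞` is taken by
dominated convergence, which requires `|⟪bₙ, aⱼ⟫| ≤ A` uniformly in `n` and `j`. This is a form of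
the duality of `H¹` and `BMO`: since `|⟪b, a⟫| ≤ ‖T a‖₁ ≤ A` for all atoms, the `L²` mean oscillation
of `b` on each ball is at most `A` (`HomType.exists_oscillation_le`); truncation is a contraction, so
it does not increase the oscillation, and the Cauchy–Schwarz inequality gives the bound for `bₙ`
(`HomType.norm_integral_clip_mul_le`).
-/

open Filter Topology
open scoped ComplexConjugate InnerProductSpace

namespace HomType

/-! ### Truncation of complex numbers -/

/-- Coordinatewise truncation of a complex number at height `n`: the nearest-point retraction
onto the square `[-n, n] × [-n, n]`. -/
def clip (n : ℕ) (z : ℂ) : ℂ :=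
  ⟨max (-n) (min n z.re), max (-n) (min n z.im)⟩

theorem abs_max_min_sub_le (n x y : ℝ) :
    |max (-n) (min n x) - max (-n) (min n y)| ≤ |x - y| :=
  calc |max (-n) (min n x) - max (-n) (min n y)| ≤ |min n x - min n y| := by
        simpa only [max_comm (-n)] using abs_max_sub_max_le_abs (min n x) (min n y) (-n)
    _ ≤ |x - y| := by simpa using abs_min_sub_min_le_max n x n y

theorem norm_clip_sub_clip_le (n : ℕ) (z w : ℂ) : ‖clip n z - clip n w‖ ≤ ‖z - w‖ := by
  rw [Complex.norm_eq_sqrt_sq_add_sq, Complex.norm_eq_sqrt_sq_add_sq]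
  refine Real.sqrt_le_sqrt (add_le_add ?_ ?_)
  · exact sq_le_sq.2 (abs_max_min_sub_le n z.re w.re)
  · exact sq_le_sq.2 (abs_max_min_sub_le n z.im w.im)

theorem clip_zero (n : ℕ) : clip n 0 = 0 := by
  simp [clip, Complex.ext_iff]

theorem norm_clip_le_norm (n : ℕ) (z : ℂ) : ‖clip n z‖ ≤ ‖z‖ := by
  simpa [clip_zero] using norm_clip_sub_clip_le n z 0

theorem norm_clip_le (n : ℕ) (z : ℂ) : ‖clip n z‖ ≤ n + n := by
  have hn : (0 : ℝ) ≤ n := n.cast_nonneg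
  have key : ∀ x : ℝ, |max (-(n : ℝ)) (min n x)| ≤ n := fun x =>
    abs_le.2 ⟨le_max_left _ _, max_le (by linarith) (min_le_left _ _)⟩
  exact (Complex.norm_le_abs_re_add_abs_im _).trans (add_le_add (key z.re) (key z.im))

theorem continuous_clip (n : ℕ) : Continuous (clip n) :=
  LipschitzWith.continuous (K := 1) <| LipschitzWith.of_dist_le_mul fun z w => by
    simpa [dist_eq_norm] using norm_clip_sub_clip_le n z w

theorem tendsto_clip (z : ℂ) : Tendsto (fun n => clip n z) atTop (𝓝 z) := by
  obtain ⟨N, hN⟩ := exists_nat_ge ‖z‖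
  refine tendsto_const_nhds.congr' ?_
  filter_upwards [eventually_ge_atTop N] with n hn
  have hzn : ‖z‖ ≤ n := hN.trans (by exact_mod_cast hn)
  have hre := abs_le.1 ((Complex.abs_re_le_norm z).trans hzn)
  have him := abs_le.1 ((Complex.abs_im_le_norm z).trans hzn)
  simp [clip, hre.1, hre.2, him.1, him.2]

/-! ### Pairings with truncated functions and mean oscillation -/

variable {M : Type*} [MeasurableSpace M] {ρ : M → M → ℝ} {μ : Measure M}

theorem integrable_mul_of_Lp_two (b a : Lp ℂ 2 μ) : Integrable (fun x => ‖b x‖ * ‖a x‖) μ :=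
  (Lp.memLp b).norm.integrable_mul (Lp.memLp a).norm

theorem integral_norm_mul_norm_le (b a : Lp ℂ 2 μ) : ∫ x, ‖b x‖ * ‖a x‖ ∂μ ≤ ‖b‖ * ‖a‖ := by
  have h := integral_mul_norm_le_Lp_mul_Lq (μ := μ) (f := b) (g := a) Real.HolderConjugate.two_two
    (by simpa using Lp.memLp b) (by simpa using Lp.memLp a)
  refine h.trans_eq ?_
  rw [Lp.norm_def, Lp.norm_def,
    (Lp.memLp b).eLpNorm_eq_integral_rpow_norm two_ne_zero ENNReal.ofNat_ne_top,
    (Lp.memLp a).eLpNorm_eq_integral_rpow_norm two_ne_zero ENNReal.ofNat_ne_top,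
    ENNReal.toReal_ofReal (by positivity), ENNReal.toReal_ofReal (by positivity)]
  simp

theorem aestronglyMeasurable_clip (n : ℕ) (b : Lp ℂ 2 μ) :
    AEStronglyMeasurable (fun x => conj (clip n (b x))) μ :=
  (Complex.continuous_conj.comp (continuous_clip n)).comp_aestronglyMeasurable
    (Lp.aestronglyMeasurable b)

theorem norm_conj_clip_le (n : ℕ) (z : ℂ) : ‖conj (clip n z)‖ ≤ n + n := by
  rw [RCLike.norm_conj]; exact norm_clip_le n z

/-- The pairing of two `L²` functions is the limit of the pairings with truncations. -/
theorem tendsto_integral_clip_mul (b a : Lp ℂ 2 μ) :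
    Tendsto (fun n : ℕ => ∫ x, conj (clip n (b x)) * a x ∂μ) atTop (𝓝 ⟪b, a⟫_ℂ) := by
  have : ⟪b, a⟫_ℂ = ∫ x, conj (b x) * a x ∂μ := by
    rw [L2.inner_def]; simp [mul_comm]
  rw [this]
  refine tendsto_integral_of_dominated_convergence _
    (fun n => (aestronglyMeasurable_clip n b).mul (Lp.aestronglyMeasurable a))
    (integrable_mul_of_Lp_two b a) (fun n => .of_forall fun x => ?_) (.of_forall fun x => ?_)
  · rw [norm_mul, RCLike.norm_conj]
    gcongr
    exact norm_clip_le_norm n _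
  · exact ((Complex.continuous_conj.tendsto _).comp (tendsto_clip _)).mul_const _

/-- If the pairings of `b` with all normalized mean-zero functions on a set `E` of finite measure
are bounded by `D`, then `b` has mean oscillation at most `D` on `E`, in the `L²` sense: the
extremal test function is a multiple of `b` minus its mean. -/
theorem exists_oscillation_le {E : Set M} (hE : MeasurableSet E) (hE0 : 0 < μ E) (hE1 : μ E < ∞)
    (b : Lp ℂ 2 μ) {D : ℝ} (hD : ∀ h : Lp ℂ 2 μ, (∀ᵐ x ∂μ, x ∉ E → h x = 0) → ∫ x, h x ∂μ = 0 →
      ‖h‖ * √(μ.real E) ≤ 1 → ‖⟪b, h⟫_ℂ‖ ≤ D) :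
    ∃ (c : ℂ) (h : Lp ℂ 2 μ), (∀ᵐ x ∂μ, x ∈ E → h x = b x - c) ∧ ‖h‖ ≤ D * √(μ.real E) := by
  set m := μ.real E with hm
  have hmpos : 0 < m := ENNReal.toReal_pos hE0.ne' hE1.ne
  have hsm : 0 < √m := Real.sqrt_pos.2 hmpos
  have : Fact (μ E < ∞) := ⟨hE1⟩
  set c : ℂ := (m : ℂ)⁻¹ * ∫ x in E, b x ∂μ with hc
  have hbE : IntegrableOn b E μ := 
    integrableOn_Lp_of_measure_ne_top b fact_one_le_two_ennreal.elim hE1.ne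
  have hmem : MemLp (E.indicator fun x => b x - c) 2 μ := by
    rw [memLp_indicator_iff_restrict hE]
    exact ((Lp.memLp b).restrict E).sub (memLp_const c)
  set h : Lp ℂ 2 μ := hmem.toLp _
  have hae : h =ᵐ[μ] E.indicator fun x => b x - c := hmem.coeFn_toLp
  have hoff : ∀ᵐ x ∂μ, x ∉ E → h x = 0 := by
    filter_upwards [hae] with x hx hxE
    rw [hx, Set.indicator_of_notMem hxE]
  have hint : ∫ x, h x ∂μ = 0 := by
    rw [integral_congr_ae hae, integral_indicator hE, integral_sub hbE (integrableOn_const hE1.ne),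
      setIntegral_const, hc, ← hm, Complex.real_smul, mul_inv_cancel_left₀, sub_self]
    exact_mod_cast hmpos.ne'
  refine ⟨c, h, ?_, ?_⟩
  · filter_upwards [hae] with x hx hxE
    rw [hx, Set.indicator_of_mem hxE]
  -- `b - h` is the constant `c` where `h` lives, and `h` has mean zero.
  have hself : ⟪b, h⟫_ℂ = ⟪h, h⟫_ℂ := by
    rw [← sub_eq_zero, ← inner_sub_left, L2.inner_def]
    have : (fun x => ⟪(b - h : Lp ℂ 2 μ) x, h x⟫_ℂ) =ᵐ[μ] fun x => conj c * h x := by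
      filter_upwards [hae, Lp.coeFn_sub b h] with x hx hs
      rw [hs, Pi.sub_apply, hx]
      by_cases hxE : x ∈ E
      · simp [hxE, mul_comm]
      · simp [hxE]
    rw [integral_congr_ae this, integral_const_mul, hint, mul_zero]
  rcases eq_or_ne h 0 with h0 | h0
  · have := hD 0 (by filter_upwards [Lp.coeFn_zero ℂ 2 μ] with x hx _ using hx)
      (by rw [integral_congr_ae (Lp.coeFn_zero ℂ 2 μ)]; simp) (by simp)
    rw [inner_zero_right, norm_zero] at this
    rw [h0, norm_zero]; positivity
  have hn : 0 < ‖h‖ := norm_pos_iff.2 h0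
  set t : ℝ := (‖h‖ * √m)⁻¹ with ht
  have htpos : 0 < t := by positivity
  have hcoe := Lp.coeFn_smul (t : ℂ) h
  have key := hD ((t : ℂ) • h)
    (by filter_upwards [hcoe, hoff] with x hx hx' hxE; rw [hx, Pi.smul_apply, hx' hxE, smul_zero])
    (by rw [integral_congr_ae hcoe]; simp [integral_const_mul, hint])
    (by
      rw [norm_smul, Complex.norm_real, Real.norm_of_nonneg htpos.le, mul_assoc, ht,
        inv_mul_cancel₀ (by positivity)])
  rw [inner_smul_right, hself, inner_self_eq_norm_sq_to_K, norm_mul, Complex.norm_real,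
    Real.norm_of_nonneg htpos.le, norm_pow] at key
  have key' : t * ‖h‖ ^ 2 ≤ D := by simpa using key
  have : t * ‖h‖ ^ 2 = ‖h‖ / √m := by
    rw [ht]; field_simp
  rwa [this, div_le_iff₀ hsm] at key'

/-- Truncation does not increase oscillations: a truncated function pairs with mean-zero functions
on `E` no worse than the function itself. -/
theorem norm_integral_clip_mul_le {E : Set M} (hE : MeasurableSet E) (hE0 : 0 < μ E)
    (hE1 : μ E < ∞) (b : Lp ℂ 2 μ) {D : ℝ} (hD : ∀ h : Lp ℂ 2 μ, (∀ᵐ x ∂μ, x ∉ E → h x = 0) →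
      ∫ x, h x ∂μ = 0 → ‖h‖ * √(μ.real E) ≤ 1 → ‖⟪b, h⟫_ℂ‖ ≤ D) (n : ℕ) (a : Lp ℂ 2 μ)
    (ha : Integrable a μ) (haE : ∀ᵐ x ∂μ, x ∉ E → a x = 0) (ha0 : ∫ x, a x ∂μ = 0)
    (ha1 : ‖a‖ * √(μ.real E) ≤ 1) : ‖∫ x, conj (clip n (b x)) * a x ∂μ‖ ≤ D := by
  obtain ⟨c, h, hc, hh⟩ := exists_oscillation_le hE hE0 hE1 b hD
  have hint : Integrable (fun x => conj (clip n (b x)) * a x) μ :=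
    ha.bdd_mul (aestronglyMeasurable_clip n b) (.of_forall fun x => norm_conj_clip_le n _)
  have heq : ∫ x, conj (clip n (b x)) * a x ∂μ
      = ∫ x, (conj (clip n (b x)) * a x - conj (clip n c) * a x) ∂μ := by
    rw [integral_sub hint (ha.const_mul _), integral_const_mul, ha0, mul_zero, sub_zero]
  have hD0 : 0 ≤ D := (norm_nonneg _).trans (hD a haE ha0 ha1)
  calc ‖∫ x, conj (clip n (b x)) * a x ∂μ‖ ≤ ∫ x, ‖h x‖ * ‖a x‖ ∂μ := by
        rw [heq]
        refine norm_integral_le_of_norm_le (integrable_mul_of_Lp_two h a) ?_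
        filter_upwards [hc, haE] with x hx hxa
        by_cases hxE : x ∈ E
        · rw [← sub_mul, ← map_sub, norm_mul, RCLike.norm_conj, hx hxE]
          gcongr
          exact norm_clip_sub_clip_le n _ _
        · simp [hxa hxE]
    _ ≤ ‖h‖ * ‖a‖ := integral_norm_mul_norm_le h a
    _ ≤ (D * √(μ.real E)) * ‖a‖ := by gcongr
    _ = D * (‖a‖ * √(μ.real E)) := by ring
    _ ≤ D := mul_le_of_le_one_right hD0 ha1

/-! ### Atoms -/

theorem IsAtom.congr_ae {q : ℝ≥0∞} {f g : M → ℂ} (h : f =ᵐ[μ] g) (hf : IsAtom ρ μ q f) :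
    IsAtom ρ μ q g := by
  obtain ⟨h1, h2, c, r, hr, h3, h4⟩ := hf
  refine ⟨(memLp_congr_ae h).1 h1, by rwa [← integral_congr_ae h], c, r, hr, ?_, ?_⟩
  · filter_upwards [h, h3] with x hx hx' hxE
    rw [← hx, hx' hxE]
  · rwa [← eLpNorm_congr_ae h]

/-- The normalization of a `(1,2)`-atom on a set of measure `m`, in terms of real numbers. -/
theorem atom_size_iff {E : Set M} (hE0 : 0 < μ E) (hE1 : μ E < ∞) (a : Lp ℂ 2 μ) :
    (μ E)⁻¹ ^ (1 / (2 : ℝ≥0∞).toReal) * eLpNorm a 2 μ ≤ (μ E)⁻¹ ↔ ‖a‖ * √(μ.real E) ≤ 1 := by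
  have hm : 0 < μ.real E := ENNReal.toReal_pos hE0.ne' hE1.ne
  have h1 : (μ E)⁻¹ ≠ ∞ := ENNReal.inv_ne_top.2 hE0.ne'
  have h2 : (μ E)⁻¹ ^ (1 / (2 : ℝ≥0∞).toReal) ≠ ∞ := ENNReal.rpow_ne_top_of_nonneg (by simp) h1
  rw [← ENNReal.toReal_le_toReal (ENNReal.mul_ne_top h2 (Lp.eLpNorm_ne_top a)) h1,
    ENNReal.toReal_mul, ← Lp.norm_def, ← ENNReal.toReal_rpow, ENNReal.toReal_inv]
  change (μ.real E)⁻¹ ^ _ * _ ≤ (μ.real E)⁻¹ ↔ _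
  have hs : 0 < √(μ.real E) := Real.sqrt_pos.2 hm
  rw [ENNReal.toReal_ofNat, ← Real.sqrt_eq_rpow, Real.sqrt_inv]
  nth_rw 2 [← Real.sq_sqrt hm.le]
  rw [inv_mul_le_iff₀ hs, sq, mul_inv, mul_inv_cancel_left₀ hs.ne', ← one_div, le_div_iff₀ hs]

/-- A set `E` carrying the atom `a`, with the normalization stated for the `L²` norm: every mean-zero
function normalized on `E` is again an atom. -/
theorem IsAtom.exists_set (hM : IsHomogeneousType ρ μ) {a : Lp ℂ 2 μ} (ha : IsAtom ρ μ 2 a) :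
    ∃ E : Set M, MeasurableSet E ∧ 0 < μ E ∧ μ E < ∞ ∧ (∀ᵐ x ∂μ, x ∉ E → a x = 0) ∧
      ‖a‖ * √(μ.real E) ≤ 1 ∧ ∀ h : Lp ℂ 2 μ, (∀ᵐ x ∂μ, x ∉ E → h x = 0) →
        ∫ x, h x ∂μ = 0 → ‖h‖ * √(μ.real E) ≤ 1 → IsAtom ρ μ 2 h := by
  obtain ⟨-, -, c, r, hr, hoff, hsize⟩ := ha
  have hpos := hM.measure_qball_pos c r hr
  have hlt := hM.measure_qball_lt_top c r hr
  exact ⟨qball ρ c r, hM.measurableSet_qball c r hr, hpos, hlt, hoff,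
    (atom_size_iff hpos hlt a).1 hsize, fun h h1 h2 h3 =>
      ⟨Lp.memLp h, h2, c, r, hr, h1, (atom_size_iff hpos hlt h).2 h3⟩⟩

/-- The `H¹`–`BMO` duality estimate for a truncated function: if `b ∈ L²` pairs with atoms with
bound `D`, then so do all its truncations. -/
theorem norm_integral_clip_mul_atom_le (hM : IsHomogeneousType ρ μ) (b : Lp ℂ 2 μ) {D : ℝ}
    (hD : ∀ h : Lp ℂ 2 μ, IsAtom ρ μ 2 h → ‖⟪b, h⟫_ℂ‖ ≤ D) (n : ℕ) {a : Lp ℂ 2 μ}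
    (ha : IsAtom ρ μ 2 a) (hint : Integrable a μ) :
    ‖∫ x, conj (clip n (b x)) * a x ∂μ‖ ≤ D := by
  obtain ⟨E, hE, hE0, hE1, hoff, hsize, hatom⟩ := ha.exists_set hM
  exact norm_integral_clip_mul_le hE hE0 hE1 b
    (fun h h1 h2 h3 => hD h (hatom h h1 h2 h3)) n a hint hoff ha.2.1 hsize

/-! ### Images of atomic decompositions -/

/-- Pairing with a bounded function commutes with sums in `L¹`. -/
theorem hasSum_integral_mul {φ : M → ℂ} (hφ : AEStronglyMeasurable φ μ) {C : ℝ}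
    (hC : ∀ x, ‖φ x‖ ≤ C) {l : ℕ → ℂ} {a : ℕ → Lp ℂ 1 μ} {g : Lp ℂ 1 μ}
    (h : HasSum (fun j => l j • a j) g) :
    HasSum (fun j => l j * ∫ x, φ x * a j x ∂μ) (∫ x, φ x * g x ∂μ) := by
  have hint : ∀ f : Lp ℂ 1 μ, Integrable (fun x => φ x * f x) μ := fun f =>
    (L1.integrable_coeFn f).bdd_mul hφ (.of_forall hC)
  let L : Lp ℂ 1 μ →ₗ[ℂ] ℂ :=
    { toFun := fun f => ∫ x, φ x * f x ∂μ
      map_add' := fun f f' => by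
        rw [← integral_add (hint f) (hint f')]
        refine integral_congr_ae ?_
        filter_upwards [Lp.coeFn_add f f'] with x hx
        rw [hx, Pi.add_apply, mul_add]
      map_smul' := fun c f => by
        rw [RingHom.id_apply, smul_eq_mul, ← integral_const_mul]
        refine integral_congr_ae ?_
        filter_upwards [Lp.coeFn_smul c f] with x hx
        rw [hx, Pi.smul_apply, smul_eq_mul, mul_left_comm] }
  let L' : Lp ℂ 1 μ →L[ℂ] ℂ := L.mkContinuous C fun f => by
    rw [L1.norm_eq_integral_norm, ← integral_const_mul]
    refine norm_integral_le_of_norm_le ((L1.integrable_coeFn f).norm.const_mul C)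
      (.of_forall fun x => ?_)
    rw [norm_mul]
    exact mul_le_mul_of_nonneg_right (hC x) (norm_nonneg _)
  have := h.mapL L'
  simp only [map_smul, smul_eq_mul] at this
  exact this

/-- `G` is the sum in `L¹` of `∑ⱼ lⱼ T aⱼ` for some atomic decomposition `∑ⱼ lⱼ aⱼ` of `g`. The
values `T aⱼ` are taken through the representatives `f j ∈ L²` of the atoms, and `u j` is `T (f j)`
seen as an element of `L¹`. -/
def IsAtomicImage (ρ : M → M → ℝ) (T : Lp ℂ 2 μ →L[ℂ] Lp ℂ 2 μ) (g G : Lp ℂ 1 μ) : Prop :=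
  ∃ (l : ℕ → ℂ) (a u : ℕ → Lp ℂ 1 μ) (f : ℕ → Lp ℂ 2 μ), IsAtomicDecomposition ρ μ 2 g l a ∧
    (∀ j, a j =ᵐ[μ] f j ∧ u j =ᵐ[μ] T (f j)) ∧ HasSum (fun j => l j • u j) G

theorem IsAtomicImage.add {T : Lp ℂ 2 μ →L[ℂ] Lp ℂ 2 μ} {g g' G G' : Lp ℂ 1 μ}
    (h : IsAtomicImage ρ T g G) (h' : IsAtomicImage ρ T g' G') :
    IsAtomicImage ρ T (g + g') (G + G') := by
  obtain ⟨l, a, u, f, hd, hf, hs⟩ := h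
  obtain ⟨l', a', u', f', hd', hf', hs'⟩ := h'
  refine ⟨_, _, fun j => Sum.elim u u' (Equiv.natSumNatEquivNat.symm j),
    fun j => Sum.elim f f' (Equiv.natSumNatEquivNat.symm j), hd.add hd', fun j => ?_, ?_⟩
  · beta_reduce
    rcases Equiv.natSumNatEquivNat.symm j with i | i
    · exact hf i
    · exact hf' i
  · exact (Equiv.natSumNatEquivNat.symm.hasSum_iff
      (f := fun x : ℕ ⊕ ℕ => Sum.elim l l' x • Sum.elim u u' x)).2 (HasSum.sum hs hs')

theorem IsAtomicImage.smul {T : Lp ℂ 2 μ →L[ℂ] Lp ℂ 2 μ} {g G : Lp ℂ 1 μ} (c : ℂ)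
    (h : IsAtomicImage ρ T g G) : IsAtomicImage ρ T (c • g) (c • G) := by
  obtain ⟨l, a, u, f, hd, hf, hs⟩ := h
  refine ⟨_, _, u, f, hd.smul c, hf, ?_⟩
  simp only [mul_smul]
  exact hs.const_smul c

variable {T : Lp ℂ 2 μ →L[ℂ] Lp ℂ 2 μ} {A : ℝ≥0}

theorem norm_image_atom_le (hA : ∀ a : Lp ℂ 2 μ, IsAtom ρ μ 2 a → eLpNorm (T a) 1 μ ≤ A)
    {a u : Lp ℂ 1 μ} {f : Lp ℂ 2 μ} (ha : IsAtom ρ μ 2 a) (haf : a =ᵐ[μ] f)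
    (hu : u =ᵐ[μ] T f) : ‖u‖ ≤ A := by
  rw [Lp.norm_def, eLpNorm_congr_ae hu]
  exact ENNReal.toReal_le_coe_of_le_coe (hA f (ha.congr_ae haf))

/-- Every atomic decomposition of `g` yields a convergent series of images, since these are bounded
by `A` in `L¹`. -/
theorem IsAtomicDecomposition.exists_image
    (hA : ∀ a : Lp ℂ 2 μ, IsAtom ρ μ 2 a → eLpNorm (T a) 1 μ ≤ A) {g : Lp ℂ 1 μ}
    {l : ℕ → ℂ} {a : ℕ → Lp ℂ 1 μ} (h : IsAtomicDecomposition ρ μ 2 g l a) :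
    ∃ G, IsAtomicImage ρ T g G ∧ ‖G‖ ≤ A * ∑' j, ‖l j‖ := by
  have hf : ∀ j, ∃ (f : Lp ℂ 2 μ) (u : Lp ℂ 1 μ), a j =ᵐ[μ] f ∧ u =ᵐ[μ] T f := fun j => by
    have hmem := (h.1 j).1
    have hae : a j =ᵐ[μ] hmem.toLp _ := hmem.coeFn_toLp.symm
    have hT1 : MemLp (T (hmem.toLp _)) 1 μ :=
      ⟨Lp.aestronglyMeasurable _, (hA _ ((h.1 j).congr_ae hae)).trans_lt ENNReal.coe_lt_top⟩
    exact ⟨hmem.toLp _, hT1.toLp _, hae, hT1.coeFn_toLp⟩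
  choose f u hfu using hf
  have hle : ∀ j, ‖l j • u j‖ ≤ A * ‖l j‖ := fun j => by
    rw [norm_smul, mul_comm]
    gcongr
    exact norm_image_atom_le hA (h.1 j) (hfu j).1 (hfu j).2
  have hsum := h.2.1.mul_left (A : ℝ)
  have hs : Summable fun j => l j • u j := .of_norm_bounded hsum hle
  refine ⟨_, ⟨l, a, u, f, h, hfu, hs.hasSum⟩, ?_⟩
  rw [← tsum_mul_left]
  exact tsum_of_norm_bounded hsum.hasSum hle

/-- On `H¹ ∩ L²` the sum of the images of the atoms does not depend on the decomposition, and is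
given by `T`. Tested against the indicator of a set `s`, the claim is that
`⟪b, ∑ⱼ lⱼ aⱼ⟫ = ∑ⱼ lⱼ ⟪b, aⱼ⟫` for `b = T† 1ₛ`; this is clear for bounded `b`, and the truncations
of `b` satisfy the uniform bound on atoms that dominated convergence requires. -/
theorem IsAtomicImage.ae_eq [SigmaFinite μ] (hM : IsHomogeneousType ρ μ)
    (hA : ∀ a : Lp ℂ 2 μ, IsAtom ρ μ 2 a → eLpNorm (T a) 1 μ ≤ A) {g G : Lp ℂ 1 μ}
    (hG : IsAtomicImage ρ T g G) {h : Lp ℂ 2 μ} (hgh : g =ᵐ[μ] h) : G =ᵐ[μ] T h := by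
  obtain ⟨l, a, u, f, ⟨ha, hl, hs⟩, hf, hsG⟩ := hG
  refine ae_eq_of_forall_setIntegral_eq_of_sigmaFinite
    (fun s _ _ => (L1.integrable_coeFn G).integrableOn)
    (fun s _ hs => integrableOn_Lp_of_measure_ne_top _ fact_one_le_two_ennreal.elim hs.ne) ?_
  intro s hms hμs
  set b : Lp ℂ 2 μ := T.adjoint (indicatorConstLp 2 hms hμs.ne 1) with hb
  have hbT : ∀ k : Lp ℂ 2 μ, ⟪b, k⟫_ℂ = ∫ x in s, T k x ∂μ := fun k => by
    rw [hb, ContinuousLinearMap.adjoint_inner_left, L2.inner_indicatorConstLp_one]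
  have hset : ∀ v : Lp ℂ 1 μ, ‖∫ x in s, v x ∂μ‖ ≤ ‖v‖ := fun v => by
    rw [L1.norm_eq_integral_norm]
    exact (norm_integral_le_integral_norm _).trans (setIntegral_le_integral
      (L1.integrable_coeFn v).norm (.of_forall fun x => norm_nonneg _))
  have hfatom : ∀ j, IsAtom ρ μ 2 (f j) := fun j => (ha j).congr_ae (hf j).1
  have hbD : ∀ k : Lp ℂ 2 μ, IsAtom ρ μ 2 k → ‖⟪b, k⟫_ℂ‖ ≤ A := fun k hk => by
    have hk1 : MemLp (T k) 1 μ :=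
      ⟨Lp.aestronglyMeasurable _, (hA k hk).trans_lt ENNReal.coe_lt_top⟩
    rw [hbT, ← integral_congr_ae (ae_restrict_of_ae hk1.coeFn_toLp)]
    refine (hset _).trans ?_
    rw [Lp.norm_toLp]
    exact ENNReal.toReal_le_coe_of_le_coe (hA k hk)
  -- The series of pairings with the truncations of `b`, and its limit as the height grows.
  have hn : ∀ n : ℕ, ∑' j, l j * ∫ x, conj (clip n (b x)) * f j x ∂μ
      = ∫ x, conj (clip n (b x)) * h x ∂μ := fun n => by
    have h1 := hasSum_integral_mul (aestronglyMeasurable_clip n b)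
      (fun x => norm_conj_clip_le n (b x)) hs
    have h2 : ∀ j, ∫ x, conj (clip n (b x)) * a j x ∂μ
        = ∫ x, conj (clip n (b x)) * f j x ∂μ := fun j => integral_congr_ae <| by
      filter_upwards [(hf j).1] with x hx
      rw [hx]
    have h3 : ∫ x, conj (clip n (b x)) * g x ∂μ
        = ∫ x, conj (clip n (b x)) * h x ∂μ := integral_congr_ae <| by
      filter_upwards [hgh] with x hx
      rw [hx]
    simp only [h2, h3] at h1
    exact h1.tsum_eq
  have hlim : Tendsto (fun n : ℕ => ∑' j, l j * ∫ x, conj (clip n (b x)) * f j x ∂μ) atTop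
      (𝓝 (∑' j, l j * ⟪b, f j⟫_ℂ)) := by
    refine tendsto_tsum_of_dominated_convergence (hl.mul_right (A : ℝ))
      (fun j => (tendsto_integral_clip_mul b (f j)).const_mul _) (.of_forall fun n j => ?_)
    rw [norm_mul]
    gcongr
    exact norm_integral_clip_mul_atom_le hM b hbD n (hfatom j)
      ((L1.integrable_coeFn (a j)).congr (hf j).1)
  simp only [hn] at hlim
  have key : ⟪b, h⟫_ℂ = ∑' j, l j * ⟪b, f j⟫_ℂ :=
    tendsto_nhds_unique (tendsto_integral_clip_mul b h) hlim
  have hsumG := hasSum_integral_mul (φ := s.indicator fun _ => (1 : ℂ)) (C := 1)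
    (aestronglyMeasurable_const.indicator hms)
    (fun x => (norm_indicator_le_norm_self _ x).trans (by simp)) hsG
  have hind : ∀ v : M → ℂ, ∫ x, s.indicator (fun _ => (1 : ℂ)) x * v x ∂μ = ∫ x in s, v x ∂μ :=
    fun v => by
      rw [← integral_indicator hms]
      congr 1 with x
      by_cases hx : x ∈ s <;> simp [hx]
  simp only [hind] at hsumG
  rw [← hbT, key, ← hsumG.tsum_eq]
  refine tsum_congr fun j => ?_
  rw [hbT, integral_congr_ae (ae_restrict_of_ae (hf j).2)]

theorem IsAtomicImage.unique [SigmaFinite μ] (hM : IsHomogeneousType ρ μ)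
    (hA : ∀ a : Lp ℂ 2 μ, IsAtom ρ μ 2 a → eLpNorm (T a) 1 μ ≤ A) {g G G' : Lp ℂ 1 μ}
    (hG : IsAtomicImage ρ T g G) (hG' : IsAtomicImage ρ T g G') : G = G' := by
  have h := hG.add (hG'.smul (-1))
  rw [neg_one_smul, neg_one_smul, add_neg_cancel, ← sub_eq_add_neg] at h
  have h0 := h.ae_eq hM hA (h := 0)
    ((Lp.coeFn_zero ℂ 1 μ).trans (Lp.coeFn_zero ℂ 2 μ).symm)
  rw [map_zero] at h0
  exact sub_eq_zero.1 (Lp.ext (h0.trans ((Lp.coeFn_zero ℂ 2 μ).trans (Lp.coeFn_zero ℂ 1 μ).symm)))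

/-- The operator that maps an atomic series to the series of the images of its atoms. -/
theorem exists_linearMap_isAtomicImage [Nonempty M] [SigmaFinite μ] (hM : IsHomogeneousType ρ μ)
    (hA : ∀ a : Lp ℂ 2 μ, IsAtom ρ μ 2 a → eLpNorm (T a) 1 μ ≤ A) :
    ∃ S : hardy ρ μ →ₗ[ℂ] Lp ℂ 1 μ, ∀ g : hardy ρ μ, IsAtomicImage ρ T g (S g) := by
  have hex : ∀ g : hardy ρ μ, ∃ G, IsAtomicImage ρ T g G := fun g => by
    obtain ⟨l, a, h⟩ := g.2
    obtain ⟨G, hG, -⟩ := h.exists_image hA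
    exact ⟨G, hG⟩
  choose S hS using hex
  exact ⟨{ toFun := S
           map_add' := fun g g' => (hS (g + g')).unique hM hA ((hS g).add (hS g'))
           map_smul' := fun c g => (hS (c • g)).unique hM hA ((hS g).smul c) }, hS⟩

/-! ### The norm of `H¹` and bounded extensions -/

theorem hardyNorm_nonneg (g : Lp ℂ 1 μ) : 0 ≤ hardyNorm ρ μ g := by
  refine Real.sInf_nonneg ?_
  rintro s ⟨l, a, -, rfl⟩
  exact tsum_nonneg fun j => norm_nonneg _

theorem IsAtomicDecomposition.hardyNorm_le {g : Lp ℂ 1 μ} {l : ℕ → ℂ} {a : ℕ → Lp ℂ 1 μ}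
    (h : IsAtomicDecomposition ρ μ 2 g l a) : hardyNorm ρ μ g ≤ ∑' j, ‖l j‖ := by
  refine csInf_le ⟨0, ?_⟩ ⟨l, a, h, rfl⟩
  rintro s ⟨l, a, -, rfl⟩
  exact tsum_nonneg fun j => norm_nonneg _

theorem IsAtom.mem_hardy [Nonempty M] {a : Lp ℂ 1 μ} (ha : IsAtom ρ μ 2 a) : a ∈ hardy ρ μ := by
  refine ⟨Pi.single 0 1, fun _ => a, fun _ => ha, ?_, ?_⟩
  · exact summable_of_ne_finset_zero (s := {0}) fun j hj => by
      rw [Pi.single_eq_of_ne (by simpa using hj), norm_zero]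
  · have := hasSum_single (f := fun j => (Pi.single 0 1 : ℕ → ℂ) j • a) 0 fun j hj => by
      rw [Pi.single_eq_of_ne hj, zero_smul]
    simpa using this

/-- A bounded extension maps an atomic series to the series of the images of its atoms, because
the partial sums converge in the norm of `H¹`. -/
theorem IsBoundedExtension.eq_of_isAtomicImage [Nonempty M] {S : hardy ρ μ →ₗ[ℂ] Lp ℂ 1 μ}
    (hS : IsBoundedExtension ρ μ T S) {g : hardy ρ μ} {G : Lp ℂ 1 μ}
    (hG : IsAtomicImage ρ T g G) : S g = G := by
  obtain ⟨⟨C, hC⟩, hfin⟩ := hS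
  obtain ⟨l, a, u, f, ⟨ha, hl, hs⟩, hf, hsG⟩ := hG
  let a' : ℕ → hardy ρ μ := fun j => ⟨a j, (ha j).mem_hardy⟩
  have hSa : ∀ j, S (a' j) = u j := fun j => Lp.ext <|
    (hfin (a' j) (f j) (Submodule.subset_span (ha j)) (hf j).1).trans (hf j).2.symm
  -- The partial sums of the images also tend to `S g`, by boundedness of `S` on the tails.
  refine tendsto_nhds_unique ?_ hsG.tendsto_sum_nat
  rw [tendsto_iff_norm_sub_tendsto_zero]
  have htail : Tendsto (fun n => |C| * ∑' j, ‖l (j + n)‖) atTop (𝓝 0) := by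
    simpa using (tendsto_sum_nat_add fun j => ‖l j‖).const_mul |C|
  refine squeeze_zero (fun _ => norm_nonneg _) (fun n => ?_) htail
  have hdec : IsAtomicDecomposition ρ μ 2
      ((g - ∑ j ∈ Finset.range n, l j • a' j : hardy ρ μ) : Lp ℂ 1 μ)
      (fun j => l (j + n)) (fun j => a (j + n)) := by
    refine ⟨fun j => ha _, (summable_nat_add_iff (f := fun j => ‖l j‖) n).2 hl, ?_⟩
    simpa [a'] using (hasSum_nat_add_iff' n).2 hs
  have hmap : S (g - ∑ j ∈ Finset.range n, l j • a' j) = S g - ∑ j ∈ Finset.range n, l j • u j := by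
    simp [hSa]
  rw [norm_sub_rev, ← hmap]
  calc _ ≤ C * hardyNorm ρ μ (g - ∑ j ∈ Finset.range n, l j • a' j : hardy ρ μ) := hC _
    _ ≤ |C| * ∑' j, ‖l (j + n)‖ :=
      mul_le_mul (le_abs_self C) hdec.hardyNorm_le (hardyNorm_nonneg _) (abs_nonneg C)

end HomType

theorem proposition4p2 {M : Type*} [MeasurableSpace M] [Nonempty M]
    (ρ : M → M → ℝ) (μ : Measure M) [SigmaFinite μ]
    (hM : HomType.IsHomogeneousType ρ μ) (hμ : μ Set.univ = ∞)
    (T : Lp ℂ 2 μ →L[ℂ] Lp ℂ 2 μ)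
    (hT : (⨆ (a : Lp ℂ 2 μ) (_ : HomType.IsAtom ρ μ 2 a), eLpNorm (T a) 1 μ) < ∞) :
    (∃! S : HomType.hardy ρ μ →ₗ[ℂ] Lp ℂ 1 μ, HomType.IsBoundedExtension ρ μ T S) ∧
      ∀ S : HomType.hardy ρ μ →ₗ[ℂ] Lp ℂ 1 μ, HomType.IsBoundedExtension ρ μ T S →
        ∀ (g : HomType.hardy ρ μ) (h : Lp ℂ 2 μ),
          (g : Lp ℂ 1 μ) =ᵐ[μ] h → S g =ᵐ[μ] T h := by
  obtain ⟨A, hA⟩ : ∃ A : ℝ≥0, ∀ a : Lp ℂ 2 μ, HomType.IsAtom ρ μ 2 a → eLpNorm (T a) 1 μ ≤ A := by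
    obtain ⟨A, hA, -⟩ := ENNReal.lt_iff_exists_coe.1 hT
    refine ⟨A, fun a ha => ?_⟩
    rw [← hA]
    exact le_iSup₂ (f := fun (a : Lp ℂ 2 μ) (_ : HomType.IsAtom ρ μ 2 a) => eLpNorm (T a) 1 μ) a ha
  obtain ⟨S, hS⟩ := HomType.exists_linearMap_isAtomicImage hM hA
  refine ⟨⟨S, ⟨⟨A, fun g => ?_⟩, fun g h _ hgh => (hS g).ae_eq hM hA hgh⟩, fun S' hS' =>
    LinearMap.ext fun g => hS'.eq_of_isAtomicImage (hS g)⟩, fun S' hS' g h hgh => ?_⟩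
  · obtain ⟨l₀, a₀, h₀⟩ := g.2
    rw [← smul_eq_mul, HomType.hardyNorm, HomType.hardyqNorm,
      ← Real.sInf_smul_of_nonneg (a := (A : ℝ)) A.coe_nonneg]
    refine le_csInf (Set.Nonempty.smul_set ⟨_, l₀, a₀, h₀, rfl⟩) ?_
    rintro _ ⟨_, ⟨l, a, hla, rfl⟩, rfl⟩
    obtain ⟨G, hG, hle⟩ := hla.exists_image hA
    rw [(hS g).unique hM hA hG]
    exact hle
  · rw [hS'.eq_of_isAtomicImage (hS g)]
    exact (hS g).ae_eq hM hA hgh
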